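/- Let $K$ be a finite or countable set of states. A repeated game with incomplete information on one side is given by $\Gamma=(K,S,T,\{g_k\}_{k\in K})$ with action sets $S,T$ and one-stage payoffs $g_k:S\times T\to\mathbb{R}$. In the $N$-stage game $\Gamma_N(\rho)$ with prior $\rho\in\Delta(K)$ (a probability measure on $K$), a state $k$ is drawn from $\rho$ and told to player 1 only; at each stage $n=1,\dots,N$ both players simultaneously choose (possibly at random) actions $s_n\in S$, $t_n\in T$ depending on the previously announced actions (and, for player 1, on $k$), and these are then announced. Player 1 receives from player 2 the amount $\sum_{n=1}^N g_k(s_n,t_n)$; let $G_N(\rho,\sigma,\tau)$ be its expectation when the players use the behavioural strategies $\sigma,\tau$. The game has value $v[\Gamma_N(\rho)]=x$ if for every $\varepsilon>0$ there are strategies $\sigma_\varepsilon,\tau_\varepsilon$ with $G_N(\rho,\sigma_\varepsilon,\tau)\ge x-\varepsilon$ for all $\tau$ and $G_N(\rho,\sigma,\tau_\varepsilon)\le x+\varepsilon$ for all $\sigma$. The non-revealing game $\Gamma^{\mathrm{NR}}_1(\rho)$ is $\Gamma_1(\rho)$ with player 1 restricted to strategies not depending on $k$; its value is defined in the same way. Let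 $\mathbf{\Gamma}(K)$ be the class of all $\Gamma$ with state set $K$ such that $S$ and $T$ are finite or countable, $\sup_{k,s,t}|g_k(s,t)|<\infty$, and for all $\rho\in\Delta(K)$ and $N\ge 1$ the games $\Gamma_N(\rho)$ and $\Gamma_1^{\mathrm{NR}}(\rho)$ have values, with $v[\Gamma_1^{\mathrm{NR}}(\rho)]=0$. Put $$e(\Gamma,\rho)=\limsup_{N\to\infty}\frac{\ln v[\Gamma_N(\rho)]}{\ln N}-\frac12\in[-\infty,\infty],\qquad \alpha(\rho)=\sup_{\Gamma\in\mathbf{\Gamma}(K)}e(\Gamma,\rho),\qquad \ln 0=-\infty .$$ Let $\rho\in\Delta(K)$. Then: 1. If $\Gamma\in\mathbf{\Gamma}(K)$ and its action sets $S$ and $T$ are finite, then for every $\delta>0$ one has $v[\Gamma_N(\rho)]=o\left(N^{1/2+\delta}\right)$ as $N\to\infty$. 2. Infinite action sets are necessary for anomalous growth: every $\Gamma\in\mathbf{\Gamma}(K)$ with $e(\Gamma,\rho)>0$ has an infinite action set ($S$ or $T$ is infinite). In particular, if $\alpha(\rho)>0$, then there is a $\Gamma\in\mathbf{\Gamma}(K)$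 with $e(\Gamma,\rho)>0$ and with $S$ or $T$ infinite. -/

import Mathlib

open Filter Topology Asymptotics

noncomputable section

/-- The data of a repeated zero-sum game with incomplete information on one side: for every state
`k : K` a one-stage payoff function on the action sets `S` (informed player P1) and
`T` (uninformed player P2). -/
structure RGII (K : Type*) (S : Type*) (T : Type*) where
  payoff : K → S → T → ℝ

namespace RGII

universe u v w

variable {K : Type u} {S : Type v} {T : Type w}

/-- A history: the list of the action pairs announced so far, in chronological order. -/
abbrev History (S : Type v) (T : Type w) := List (S × T)

/-- A behavioural strategy of the informed player: a mixed action for every state and every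
history. In the `N`-stage game only its values on histories of length `< N` matter. -/
abbrev Strategy1 (K : Type u) (S : Type v) (T : Type w) := K → History S T → PMF S

/-- A behavioural strategy of the uninformed player. -/
abbrev Strategy2 (S : Type v) (T : Type w) := History S T → PMF T

/-- The joint law of the state and of the history after `n` stages generated by the prior `ρ` and
the strategies `σ`, `τ`: at every stage the two players choose their actions simultaneously
and independently given what they know. -/
def law (ρ : PMF K) (σ : Strategy1 K S T) (τ : Strategy2 S T) : ℕ → PMF (K × History S T)
  | 0 => ρ.map fun k => (k, [])
  | n + 1 => (law ρ σ τ n).bind fun ω =>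
      (σ ω.1 ω.2).bind fun s => (τ ω.2).map fun t => (ω.1, ω.2 ++ [(s, t)])

/-- The total payoff of P1 along a history in state `k`. -/
def total (Γ : RGII K S T) (k : K) (h : History S T) : ℝ :=
  (h.map fun a => Γ.payoff k a.1 a.2).sum

/-- The expected total gain `G_N(ρ, σ, τ)` of P1 in the `N`-stage game (the series converges
absolutely as soon as the payoffs are bounded). -/
def gain (Γ : RGII K S T) (N : ℕ) (ρ : PMF K) (σ : Strategy1 K S T) (τ : Strategy2 S T) : ℝ :=
  ∑' ω : K × History S T, (law ρ σ τ N ω).toReal * Γ.total ω.1 ω.2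

/-- `x` is the value of the `N`-stage game `Γ_N(ρ)`: for every `ε > 0` both players have
`ε`-optimal strategies with respect to `x`. -/
def IsValue (Γ : RGII K S T) (N : ℕ) (ρ : PMF K) (x : ℝ) : Prop :=
  ∀ ε : ℝ, 0 < ε → ∃ (σ₀ : Strategy1 K S T) (τ₀ : Strategy2 S T),
    (∀ τ : Strategy2 S T, x - ε ≤ Γ.gain N ρ σ₀ τ) ∧
    (∀ σ : Strategy1 K S T, Γ.gain N ρ σ τ₀ ≤ x + ε)

/-- `x` is the value of the non-revealing one-stage game: P1 is restricted to strategies that do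
not depend on the state. -/
def IsNRValue (Γ : RGII K S T) (ρ : PMF K) (x : ℝ) : Prop :=
  ∀ ε : ℝ, 0 < ε → ∃ (σ₀ : History S T → PMF S) (τ₀ : Strategy2 S T),
    (∀ τ : Strategy2 S T, x - ε ≤ Γ.gain 1 ρ (fun _ => σ₀) τ) ∧
    (∀ σ : History S T → PMF S, Γ.gain 1 ρ (fun _ => σ) τ₀ ≤ x + ε)

theorem IsValue.unique {Γ : RGII K S T} {N : ℕ} {ρ : PMF K} {x y : ℝ}
    (hx : Γ.IsValue N ρ x) (hy : Γ.IsValue N ρ y) : x = y := by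
  have key : ∀ {a b : ℝ}, Γ.IsValue N ρ a → Γ.IsValue N ρ b → a ≤ b := by
    intro a b ha hb
    refine le_of_forall_pos_le_add fun ε hε => ?_
    obtain ⟨σ, _, h1, _⟩ := ha (ε / 2) (by positivity)
    obtain ⟨_, τ, _, h2⟩ := hb (ε / 2) (by positivity)
    linarith [h1 τ, h2 σ]
  exact le_antisymm (key hx hy) (key hy hx)

open Classical in
/-- The value `v[Γ_N(ρ)]` (with the default `0` if the game has no value). -/
def value (Γ : RGII K S T) (N : ℕ) (ρ : PMF K) : ℝ :=
  if h : ∃ x, Γ.IsValue N ρ x then h.choose else 0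

theorem IsValue.value_eq {Γ : RGII K S T} {N : ℕ} {ρ : PMF K} {x : ℝ}
    (hx : Γ.IsValue N ρ x) : Γ.value N ρ = x := by
  have h : ∃ x, Γ.IsValue N ρ x := ⟨x, hx⟩
  rw [value, dif_pos h]
  exact h.choose_spec.unique hx

/-- The class `𝚪(K)`: the action sets are finite or countable, the payoffs are uniformly bounded,
all games `Γ_N(ρ)` with `N ≥ 1` have a value, and all non-revealing one-stage games have the
value `0`. -/
structure MemClass (Γ : RGII K S T) : Prop where
  countable_left : Countable S
  countable_right : Countable T
  bounded : ∃ C : ℝ, ∀ k s t, |Γ.payoff k s t| ≤ C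
  hasValue : ∀ (ρ : PMF K) (N : ℕ), 1 ≤ N → ∃ x, Γ.IsValue N ρ x
  nrValue : ∀ ρ : PMF K, Γ.IsNRValue ρ 0

/-- The growth exponent `limsup_N ln v[Γ_N(ρ)] / ln N - 1/2`, an extended real number, where
`ln 0 = -∞`. -/
def growthExponent (Γ : RGII K S T) (ρ : PMF K) : EReal :=
  limsup (fun N : ℕ =>
    ENNReal.log (ENNReal.ofReal (Γ.value N ρ)) / ((Real.log (N : ℝ) : ℝ) : EReal)) atTop
    - (((1 : ℝ) / 2 : ℝ) : EReal)

/-- `α(ρ)`: the supremum of the growth exponents over the class `𝚪(K)`. As action sets in the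
class are countable, it is enough to let them range over `Type`. -/
def alpha (ρ : PMF K) : EReal :=
  ⨆ (S : Type) (T : Type) (Γ : RGII K S T) (_ : Γ.MemClass), Γ.growthExponent ρ

end RGII

end

namespace RGII

universe u v w

variable {K : Type u} {S : Type v} {T : Type w}

/-! Player 1 gains only by revealing information, and a finite game offers little to reveal. Fix a
nearly optimal `σ`. Knowing `σ`, player 2 can compute the posterior at every history and play a good
action of the non-revealing game there. The stage gain is then at most the payoff bound times the L¹
distance between the joint law of (state, action) and the product of its marginals. By a linearised
Pinsker inequality this distance is at most `A / 2` times the mutual information plus `2 / A`. The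
mutual informations of successive stages telescope to at most the initial entropy, so `A = √N` gives
a bound of order `√N` times entropy.

The prior itself may have infinite entropy. With finite `S` and `T`, however, rounding payoffs to
mesh `1 / N` costs at most one unit in total and leaves polynomially many payoff matrices, hence
entropy `O(log N)`. The induction is `exists_tsum_mul_pay_le`, the resulting bound
`MemClass.value_le`. The claims on infinite action sets follow by contraposition. -/

/-! ### Laws of histories and expected payoffs, state by state -/

/-- The law of the history after `n` stages in a fixed state. -/
noncomputable def historyLaw (x : History S T → PMF S) (y : History S T → PMF T) :
    ℕ → PMF (History S T)
  | 0 => PMF.pure []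
  | n + 1 => (historyLaw x y n).bind fun h =>
      (x h).bind fun s => (y h).map fun t => h ++ [(s, t)]

theorem law_eq_bind (ρ : PMF K) (σ : Strategy1 K S T) (τ : Strategy2 S T) (n : ℕ) :
    law ρ σ τ n = ρ.bind fun k => (historyLaw (σ k) τ n).map fun h => (k, h) := by
  induction n with
  | zero => simp [law, historyLaw, PMF.map, Function.comp_def]
  | succ n ih =>
    simp only [law, ih, historyLaw, PMF.bind_bind, PMF.map_bind, PMF.bind_map, PMF.map_comp,
      Function.comp_def]

/-- The definition splits off the last stage; the inductions on the number of remaining stages need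
the first stage split off instead. -/
theorem historyLaw_succ (x : History S T → PMF S) (y : History S T → PMF T) (n : ℕ) :
    historyLaw x y (n + 1) = (x []).bind fun s => (y []).bind fun t =>
      (historyLaw (fun h => x ((s, t) :: h)) (fun h => y ((s, t) :: h)) n).map
        fun h => (s, t) :: h := by
  induction n with
  | zero => simp [historyLaw, PMF.map, Function.comp_def]
  | succ n ih =>
    rw [historyLaw, ih]
    simp only [historyLaw, PMF.bind_bind, PMF.map_bind, PMF.bind_map, PMF.map_comp,
      Function.comp_def, List.cons_append]

theorem length_eq_of_historyLaw_ne_zero {x : History S T → PMF S} {y : History S T → PMF T}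
    {n : ℕ} {h : History S T} (hh : historyLaw x y n h ≠ 0) : h.length = n := by
  induction n generalizing h with
  | zero =>
    rw [← PMF.mem_support_iff] at hh
    simp [historyLaw] at hh
    simp [hh]
  | succ n ih =>
    rw [← PMF.mem_support_iff] at hh
    simp only [historyLaw, PMF.mem_support_bind_iff, PMF.mem_support_map_iff] at hh
    obtain ⟨h', h1, s, -, t, -, rfl⟩ := hh
    simp [ih h1]

theorem law_apply (ρ : PMF K) (σ : Strategy1 K S T) (τ : Strategy2 S T) (n : ℕ) (k : K)
    (h : History S T) : law ρ σ τ n (k, h) = ρ k * historyLaw (σ k) τ n h := by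
  classical
  rw [law_eq_bind, PMF.bind_apply, tsum_eq_single k]
  · congr 1
    rw [PMF.map_apply, tsum_eq_single h]
    · simp
    · intro h' hh
      simp [hh.symm]
  · intro k' hk
    simp [PMF.map_apply, hk.symm]

theorem summable_toReal {α : Type*} (p : PMF α) : Summable fun a => (p a).toReal :=
  ENNReal.summable_toReal p.tsum_coe_ne_top

theorem tsum_toReal {α : Type*} (p : PMF α) : ∑' a, (p a).toReal = 1 := by
  rw [← ENNReal.tsum_toReal_eq p.apply_ne_top, p.tsum_coe, ENNReal.toReal_one]

theorem sum_toReal {α : Type*} [Fintype α] (p : PMF α) : ∑ a, (p a).toReal = 1 := by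
  rw [← tsum_fintype (L := .unconditional _), tsum_toReal]

/-- The expected total payoff over `n` stages in a state with payoff function `g`. -/
noncomputable def pay [Fintype S] [Fintype T] (g : S → T → ℝ) :
    ℕ → (History S T → PMF S) → (History S T → PMF T) → ℝ
  | 0, _, _ => 0
  | n + 1, x, y => ∑ s, ∑ t, (x [] s).toReal * (y [] t).toReal *
      (g s t + pay g n (fun h => x ((s, t) :: h)) (fun h => y ((s, t) :: h)))

theorem sum_sum_pmf_le [Fintype S] [Fintype T] (p : PMF S) (q : PMF T) {f : S → T → ℝ} {B : ℝ}
    (hf : ∀ s t, f s t ≤ B) : ∑ s, ∑ t, (p s).toReal * (q t).toReal * f s t ≤ B := by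
  calc ∑ s, ∑ t, (p s).toReal * (q t).toReal * f s t
      ≤ ∑ s, ∑ t, (p s).toReal * (q t).toReal * B := by
        gcongr
        exact hf _ _
    _ = B := by simp_rw [← Finset.sum_mul, ← Finset.mul_sum, sum_toReal, mul_one, sum_toReal, one_mul]

theorem abs_pay_le [Fintype S] [Fintype T] {g : S → T → ℝ} {C : ℝ} (hg : ∀ s t, |g s t| ≤ C)
    (n : ℕ) (x : History S T → PMF S) (y : History S T → PMF T) : |pay g n x y| ≤ n * C := by
  induction n generalizing x y with
  | zero => simp [pay]
  | succ n ih =>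
    rw [pay]
    refine (Finset.abs_sum_le_sum_abs _ _).trans ?_
    refine (Finset.sum_le_sum fun s _ => Finset.abs_sum_le_sum_abs _ _).trans ?_
    simp only [abs_mul, ENNReal.abs_toReal]
    refine sum_sum_pmf_le _ _ fun s t => (abs_add_le _ _).trans ?_
    push_cast
    linarith [hg s t, ih (fun h => x ((s, t) :: h)) (fun h => y ((s, t) :: h))]

theorem abs_total_le {Γ : RGII K S T} {C : ℝ} (hC : ∀ k s t, |Γ.payoff k s t| ≤ C) (k : K)
    (h : History S T) : |Γ.total k h| ≤ h.length * C := by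
  induction h with
  | nil => simp [total]
  | cons a h ih =>
    have : Γ.total k (a :: h) = Γ.payoff k a.1 a.2 + Γ.total k h := by simp [total]
    rw [this]
    refine (abs_add_le _ _).trans ?_
    push_cast [List.length_cons]
    linarith [hC k a.1 a.2]

theorem abs_historyLaw_mul_total_le {Γ : RGII K S T} {C : ℝ}
    (hC : ∀ k s t, |Γ.payoff k s t| ≤ C) (k : K) (x : History S T → PMF S)
    (y : History S T → PMF T) (n : ℕ) (h : History S T) :
    |(historyLaw x y n h).toReal * Γ.total k h| ≤ (historyLaw x y n h).toReal * (n * C) := by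
  rw [abs_mul, ENNReal.abs_toReal]
  by_cases hh : historyLaw x y n h = 0
  · simp [hh]
  · have := abs_total_le hC k h
    rw [length_eq_of_historyLaw_ne_zero hh] at this
    gcongr

theorem hasSum_map_cons (p : PMF (History S T)) (a : S × T) {f : History S T → ℝ} {r : ℝ}
    (hf : HasSum (fun h => (p h).toReal * f (a :: h)) r) :
    HasSum (fun h => (p.map (fun h => a :: h) h).toReal * f h) r := by
  classical
  have hinj : Function.Injective (fun h : History S T => a :: h) := List.cons_injective
  rw [← hinj.hasSum_iff]
  · convert hf using 2 with h
    simp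
  · intro h hh
    have : p.map (fun h => a :: h) h = 0 := by
      rw [PMF.apply_eq_zero_iff, PMF.mem_support_map_iff]
      rintro ⟨h', -, rfl⟩
      exact hh ⟨h', rfl⟩
    simp [this]

theorem historyLaw_succ_toReal [Fintype S] [Fintype T] (x : History S T → PMF S)
    (y : History S T → PMF T) (n : ℕ) (h : History S T) :
    (historyLaw x y (n + 1) h).toReal = ∑ s, ∑ t, (x [] s).toReal * (y [] t).toReal *
      ((historyLaw (fun h => x ((s, t) :: h)) (fun h => y ((s, t) :: h)) n).map
        (fun h => (s, t) :: h) h).toReal := by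
  rw [historyLaw_succ, PMF.bind_apply, tsum_fintype, ENNReal.toReal_sum]
  · refine Finset.sum_congr rfl fun s _ => ?_
    rw [ENNReal.toReal_mul, PMF.bind_apply, tsum_fintype, ENNReal.toReal_sum, Finset.mul_sum]
    · simp only [ENNReal.toReal_mul, mul_assoc]
    · exact fun t _ => ENNReal.mul_ne_top (PMF.apply_ne_top _ _) (PMF.apply_ne_top _ _)
  · exact fun t _ => ENNReal.mul_ne_top (PMF.apply_ne_top _ _) (PMF.apply_ne_top _ _)

theorem hasSum_historyLaw_mul_total [Fintype S] [Fintype T] (Γ : RGII K S T) (k : K) (n : ℕ)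
    (x : History S T → PMF S) (y : History S T → PMF T) :
    HasSum (fun h => (historyLaw x y n h).toReal * Γ.total k h) (pay (Γ.payoff k) n x y) := by
  classical
  induction n generalizing x y with
  | zero =>
    convert hasSum_zero (α := ℝ) (β := History S T) using 2 with h
    by_cases hh : h = []
    · simp [hh, total]
    · simp [historyLaw, hh]
    · rfl
  | succ n ih =>
    simp only [historyLaw_succ_toReal, Finset.sum_mul, pay]
    refine hasSum_sum fun s _ => hasSum_sum fun t _ => ?_
    simp only [mul_assoc]
    refine HasSum.mul_left _ (HasSum.mul_left _ (hasSum_map_cons _ _ ?_))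
    have h1 := (summable_toReal (historyLaw (fun h => x ((s, t) :: h))
      (fun h => y ((s, t) :: h)) n)).hasSum
    rw [tsum_toReal] at h1
    have h2 := (h1.mul_left (Γ.payoff k s t)).add
      (ih (fun h => x ((s, t) :: h)) (fun h => y ((s, t) :: h)))
    rw [mul_one] at h2
    refine (congrArg (HasSum · _) (funext fun h => ?_)).mpr h2
    simp only [total, List.map_cons, List.sum_cons]
    ring

theorem gain_eq_tsum_pay [Fintype S] [Fintype T] {Γ : RGII K S T} {C : ℝ}
    (hC : ∀ k s t, |Γ.payoff k s t| ≤ C) (N : ℕ) (ρ : PMF K) (σ : Strategy1 K S T)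
    (τ : Strategy2 S T) :
    Γ.gain N ρ σ τ = ∑' k, (ρ k).toReal * pay (Γ.payoff k) N (σ k) τ := by
  have hs : Summable fun ω : K × History S T => (law ρ σ τ N ω).toReal * Γ.total ω.1 ω.2 := by
    refine Summable.of_norm_bounded ((summable_toReal (law ρ σ τ N)).mul_right (N * C)) ?_
    rintro ⟨k, h⟩
    rw [law_apply, ENNReal.toReal_mul, mul_assoc, mul_assoc, norm_mul]
    rw [Real.norm_eq_abs, ENNReal.abs_toReal]
    exact mul_le_mul_of_nonneg_left (abs_historyLaw_mul_total_le hC k _ _ N h)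
      ENNReal.toReal_nonneg
  rw [gain, hs.tsum_prod]
  refine tsum_congr fun k => ?_
  simp only [law_apply, ENNReal.toReal_mul, mul_assoc]
  rw [tsum_mul_left, (hasSum_historyLaw_mul_total Γ k N (σ k) τ).tsum_eq]

/-! ### Entropy inequalities -/

/-- Hellinger distance against relative entropy: multiply `log u ≤ u - 1` at `u = 1 / √x` by `x`. -/
theorem sq_sqrt_sub_one_le {x : ℝ} (hx : 0 ≤ x) : (√x - 1) ^ 2 ≤ x * Real.log x - x + 1 := by
  rcases hx.eq_or_lt with rfl | hx
  · simp
  have h := Real.log_le_sub_one_of_pos (inv_pos.2 (Real.sqrt_pos.2 hx))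
  rw [Real.log_inv, Real.log_sqrt hx.le] at h
  have h1 : x * (√x)⁻¹ = √x := by
    rw [← div_eq_mul_inv, Real.div_sqrt]
  have h2 := mul_le_mul_of_nonneg_left h hx.le
  nlinarith [Real.sq_sqrt hx.le]

/-- Factor `x - 1` through `√x` and apply Young's inequality with weight `A`. Unlike Pinsker's
square root, this bound is linear in the entropy term, so it can be summed over stages directly. -/
theorem abs_sub_one_le_mul_log {x A : ℝ} (hx : 0 ≤ x) (hA : 0 < A) :
    |x - 1| ≤ A / 2 * (x * Real.log x - x + 1) + (x + 1) / A := by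
  have h0 := sq_sqrt_sub_one_le hx
  have hs := Real.sq_sqrt hx
  have hr := Real.sqrt_nonneg x
  set r := √x
  have h1 : |x - 1| = |r - 1| * (r + 1) := by
    have : x - 1 = (r - 1) * (r + 1) := by rw [← hs]; ring
    rw [this, abs_mul, abs_of_nonneg (a := r + 1) (by positivity)]
  have h2 : |r - 1| * (r + 1) ≤ A / 2 * (r - 1) ^ 2 + (r + 1) ^ 2 / (2 * A) := by
    rw [← sq_abs (r - 1)]
    have : A / 2 * |r - 1| ^ 2 + (r + 1) ^ 2 / (2 * A) - |r - 1| * (r + 1)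
        = (A * |r - 1| - (r + 1)) ^ 2 / (2 * A) := by
      field_simp
      ring
    have : 0 ≤ (A * |r - 1| - (r + 1)) ^ 2 / (2 * A) := by positivity
    linarith
  have h3 : (r + 1) ^ 2 / (2 * A) ≤ (x + 1) / A := by
    rw [div_le_div_iff₀ (by positivity) hA]
    nlinarith [mul_nonneg hA.le (sq_nonneg (r - 1))]
  have h4 := mul_le_mul_of_nonneg_left h0 (half_pos hA).le
  linarith

theorem abs_sub_le_log {a b A : ℝ} (ha : 0 ≤ a) (hb : 0 ≤ b) (hab : b = 0 → a = 0) (hA : 0 < A) :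
    |a - b| ≤ A / 2 * (a * (Real.log a - Real.log b) - a + b) + (a + b) / A := by
  rcases hb.eq_or_lt with rfl | hb
  · simp [hab rfl]
  have h := mul_le_mul_of_nonneg_left (abs_sub_one_le_mul_log (div_nonneg ha hb.le) hA) hb.le
  have hl : a / b * Real.log (a / b) = a / b * (Real.log a - Real.log b) := by
    rcases ha.eq_or_lt with rfl | ha
    · simp
    · rw [Real.log_div ha.ne' hb.ne']
  have h1 : b * |a / b - 1| = |a - b| := by
    nth_rw 1 [← abs_of_pos hb]
    rw [← abs_mul]
    congr 1
    field_simp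
  rw [h1, hl] at h
  refine h.trans_eq ?_
  field_simp

/-- The entropy of a nonnegative vector, homogeneous of degree one: its total mass times the
Shannon entropy of its normalization. -/
noncomputable def massEntropy {ι : Type*} [Fintype ι] (P : ι → ℝ) : ℝ :=
  ∑ i, Real.negMulLog (P i) - Real.negMulLog (∑ i, P i)

theorem massEntropy_nonneg {ι : Type*} [Fintype ι] {P : ι → ℝ} (hP : ∀ i, 0 ≤ P i) :
    0 ≤ massEntropy P := by
  have key : ∀ i, P i * Real.log (P i) ≤ P i * Real.log (∑ i, P i) := fun i => by
    rcases (hP i).eq_or_lt with h | h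
    · simp [← h]
    · exact mul_le_mul_of_nonneg_left (Real.log_le_log h
        (Finset.single_le_sum (fun j _ => hP j) (Finset.mem_univ i))) h.le
  have := Finset.sum_le_sum fun i (_ : i ∈ Finset.univ) => key i
  rw [← Finset.sum_mul] at this
  simp only [massEntropy, Real.negMulLog, neg_mul, Finset.sum_neg_distrib]
  linarith

theorem massEntropy_le_log_card {ι : Type*} [Fintype ι] [Nonempty ι] {P : ι → ℝ}
    (hP : ∀ i, 0 ≤ P i) (h1 : ∑ i, P i = 1) : massEntropy P ≤ Real.log (Fintype.card ι) := by
  have hM : (0 : ℝ) < Fintype.card ι := by exact_mod_cast Fintype.card_pos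
  have key : ∀ i, Real.negMulLog (P i) - P i * Real.log (Fintype.card ι)
      ≤ (Fintype.card ι : ℝ)⁻¹ - P i := fun i => by
    rcases (hP i).eq_or_lt with h | h
    · rw [← h]
      simp
    · have := mul_le_mul_of_nonneg_left
        (Real.log_le_sub_one_of_pos (inv_pos.2 (mul_pos hM h))) h.le
      rw [Real.log_inv, Real.log_mul hM.ne' h.ne'] at this
      have e : P i * (((Fintype.card ι : ℝ) * P i)⁻¹ - 1) = (Fintype.card ι : ℝ)⁻¹ - P i := by
        field_simp
      rw [e] at this
      rw [Real.negMulLog]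
      linarith
  have := Finset.sum_le_sum fun i (_ : i ∈ Finset.univ) => key i
  simp only [Finset.sum_sub_distrib, ← Finset.sum_mul, h1, Finset.sum_const, Finset.card_univ,
    nsmul_eq_mul, mul_inv_cancel₀ hM.ne'] at this
  rw [massEntropy, h1, Real.negMulLog_one]
  linarith

/-- Summing the relative entropies of `a i s` to the product of marginals gives the mutual
information: entropy before the action minus entropy after it. The linear terms cancel because both
arrays have the same mass. -/
theorem sum_abs_sub_mul_div_le {ι S : Type*} [Fintype ι] [Fintype S] {a : ι → S → ℝ}
    (ha : ∀ i s, 0 ≤ a i s) {A : ℝ} (hA : 0 < A) :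
    ∑ i, ∑ s, |a i s - (∑ s, a i s) * (∑ i, a i s) / ∑ i, ∑ s, a i s| ≤
      A / 2 * (massEntropy (fun i => ∑ s, a i s) - ∑ s, massEntropy fun i => a i s)
        + 2 * (∑ i, ∑ s, a i s) / A := by
  set P : ι → ℝ := fun i => ∑ s, a i s
  set Q : S → ℝ := fun s => ∑ i, a i s
  set W : ℝ := ∑ i, P i with hWdef
  have hP : ∀ i, 0 ≤ P i := fun i => Finset.sum_nonneg fun s _ => ha i s
  have hQ : ∀ s, 0 ≤ Q s := fun s => Finset.sum_nonneg fun i _ => ha i s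
  have hW : 0 ≤ W := Finset.sum_nonneg fun i _ => hP i
  have haP : ∀ i s, a i s ≤ P i := fun i s =>
    Finset.single_le_sum (fun s _ => ha i s) (Finset.mem_univ s)
  have haQ : ∀ i s, a i s ≤ Q s := fun i s =>
    Finset.single_le_sum (f := fun i => a i s) (fun i _ => ha i s) (Finset.mem_univ i)
  have hPW : ∀ i, P i ≤ W := fun i =>
    Finset.single_le_sum (fun i _ => hP i) (Finset.mem_univ i)
  have hWQ : ∑ s, Q s = W := Finset.sum_comm
  have hlog : ∀ i s, a i s * (Real.log (a i s) - Real.log (P i * Q s / W)) =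
      -Real.negMulLog (a i s) - a i s * Real.log (P i) - a i s * Real.log (Q s)
        + a i s * Real.log W := fun i s => by
    rcases (ha i s).eq_or_lt with h | h
    · simp [← h]
    · have h1 := h.trans_le (haP i s)
      have h2 := h.trans_le (haQ i s)
      have h3 := h1.trans_le (hPW i)
      rw [Real.log_div (by positivity) h3.ne', Real.log_mul h1.ne' h2.ne', Real.negMulLog]
      ring
  have hsumb : ∑ i, ∑ s, P i * Q s / W = W := by
    simp_rw [mul_div_assoc, ← Finset.mul_sum, ← Finset.sum_div, hWQ, ← Finset.sum_mul]
    -- For zero mass, division by zero returns 0, which is the right total.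
    rcases eq_or_ne W 0 with h | h
    · rw [h]; simp
    · rw [← hWdef, div_self h, mul_one]
  have hsuma : ∑ i, ∑ s, a i s = W := rfl
  have hsumlog : ∑ i, ∑ s, a i s * (Real.log (a i s) - Real.log (P i * Q s / W)) =
      massEntropy P - ∑ s, massEntropy fun i => a i s := by
    have e1 : ∑ i, ∑ s, a i s * Real.log (Q s) = ∑ s, Q s * Real.log (Q s) := by
      rw [Finset.sum_comm]
      simp_rw [← Finset.sum_mul]
      rfl
    have e2 : ∑ i, ∑ s, Real.negMulLog (a i s) = ∑ s, ∑ i, Real.negMulLog (a i s) :=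
      Finset.sum_comm
    have e3 : ∑ i, ∑ s, a i s * Real.log (P i) = ∑ i, P i * Real.log (P i) := by
      simp_rw [← Finset.sum_mul]
      rfl
    have e4 : ∑ i, ∑ s, a i s * Real.log W = W * Real.log W := by
      simp_rw [← Finset.sum_mul]
      rfl
    have e5 : ∑ i, Real.negMulLog (P i) = -∑ i, P i * Real.log (P i) := by
      simp [Real.negMulLog]
    have e6 : ∑ s, Real.negMulLog (Q s) = -∑ s, Q s * Real.log (Q s) := by
      simp [Real.negMulLog]
    have e7 : Real.negMulLog W = -(W * Real.log W) := by
      simp [Real.negMulLog]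
    have e8 : ∑ s, massEntropy (fun i => a i s) =
        ∑ s, ∑ i, Real.negMulLog (a i s) - ∑ s, Real.negMulLog (Q s) := by
      rw [← Finset.sum_sub_distrib]
      rfl
    have e9 : massEntropy P = ∑ i, Real.negMulLog (P i) - Real.negMulLog W := rfl
    simp only [hlog, Finset.sum_add_distrib, Finset.sum_sub_distrib, Finset.sum_neg_distrib]
    linarith
  calc ∑ i, ∑ s, |a i s - P i * Q s / W|
      ≤ ∑ i, ∑ s, (A / 2 * (a i s * (Real.log (a i s) - Real.log (P i * Q s / W)) - a i s
          + P i * Q s / W) + (a i s + P i * Q s / W) / A) := by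
        gcongr with i _ s _
        refine abs_sub_le_log (ha i s) (div_nonneg (mul_nonneg (hP i) (hQ s)) hW) ?_ hA
        intro h
        refine le_antisymm ?_ (ha i s)
        rcases div_eq_zero_iff.1 h with h | h
        · rcases mul_eq_zero.1 h with h | h
          · exact h ▸ haP i s
          · exact h ▸ haQ i s
        · exact h ▸ (haP i s).trans (hPW i)
    _ = _ := by
        obtain ⟨b, hb⟩ : ∃ b : ι → S → ℝ, ∀ i s, P i * Q s / W = b i s :=
          ⟨_, fun _ _ => rfl⟩
        simp only [hb] at hsumb hsumlog ⊢
        simp only [Finset.sum_add_distrib, Finset.sum_sub_distrib, ← Finset.mul_sum,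
          ← Finset.sum_div, hsumlog, hsumb, hsuma]
        ring

/-! ### Gain in a single stage -/

theorem abs_sum_pmf_mul_le [Fintype T] (q : PMF T) {f : T → ℝ} {B : ℝ} (hf : ∀ t, |f t| ≤ B) :
    |∑ t, (q t).toReal * f t| ≤ B := by
  calc |∑ t, (q t).toReal * f t| ≤ ∑ t, |(q t).toReal * f t| := Finset.abs_sum_le_sum_abs _ _
    _ = ∑ t, (q t).toReal * |f t| := by simp only [abs_mul, ENNReal.abs_toReal]
    _ ≤ ∑ t, (q t).toReal * B := by
        gcongr
        exact hf _
    _ = B := by rw [← Finset.sum_mul, sum_toReal, one_mul]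

/-- If the uninformed player plays a mixed action that is good against the current beliefs `P`,
the informed player's gain in one stage is controlled by the information revealed. -/
theorem stage_le [Fintype S] [Fintype T] {ι : Type*} [Fintype ι] {g : ι → S → T → ℝ} {C : ℝ}
    (hC0 : 0 ≤ C) (hg : ∀ i s t, |g i s t| ≤ C) {a : ι → S → ℝ} (ha : ∀ i s, 0 ≤ a i s) {A η : ℝ}
    (hA : 0 < A) (y : PMF T)
    (hy : ∀ s, ∑ i, (∑ s, a i s) * ∑ t, (y t).toReal * g i s t ≤ η * ∑ i, ∑ s, a i s) :
    ∑ s, ∑ i, a i s * ∑ t, (y t).toReal * g i s t ≤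
      C * (A / 2 * (massEntropy (fun i => ∑ s, a i s) - ∑ s, massEntropy fun i => a i s)
        + 2 * (∑ i, ∑ s, a i s) / A) + η * ∑ i, ∑ s, a i s := by
  have h1 := mul_le_mul_of_nonneg_left (sum_abs_sub_mul_div_le ha hA) hC0
  refine le_trans ?_ (add_le_add_left h1 _)
  set W := ∑ i, ∑ s, a i s with hW
  have hW0 : 0 ≤ W := Finset.sum_nonneg fun i _ => Finset.sum_nonneg fun s _ => ha i s
  -- Deviation from independence is charged at rate `C`; the independent part is a non-revealing
  -- game, controlled by `hy`.
  have hsplit : ∀ s i, a i s * ∑ t, (y t).toReal * g i s t ≤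
      C * |a i s - (∑ s, a i s) * (∑ i, a i s) / W|
      + (∑ i, a i s) / W * ((∑ s, a i s) * ∑ t, (y t).toReal * g i s t) := fun s i => by
    have h2 := abs_sum_pmf_mul_le y (hg i s)
    set G := ∑ t, (y t).toReal * g i s t
    have h3 : (a i s - (∑ s, a i s) * (∑ i, a i s) / W) * G ≤
        C * |a i s - (∑ s, a i s) * (∑ i, a i s) / W| := by
      refine (le_abs_self _).trans ?_
      rw [abs_mul, mul_comm]
      gcongr
    refine le_trans (le_of_eq ?_) (add_le_add_left h3 _)
    ring
  refine (Finset.sum_le_sum fun s _ => Finset.sum_le_sum fun i _ => hsplit s i).trans ?_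
  simp only [Finset.sum_add_distrib, ← Finset.mul_sum]
  rw [Finset.sum_comm]
  refine add_le_add_right ?_ _
  calc ∑ s, (∑ i, a i s) / W * ∑ i, (∑ s, a i s) * ∑ t, (y t).toReal * g i s t
      ≤ ∑ s, (∑ i, a i s) / W * (η * W) := by
        refine Finset.sum_le_sum fun s _ => mul_le_mul_of_nonneg_left (hy s) ?_
        exact div_nonneg (Finset.sum_nonneg fun i _ => ha i s) hW0
    _ = η * W := by
        rw [← Finset.sum_mul, ← Finset.sum_div, Finset.sum_comm, ← hW]
        rcases eq_or_ne W 0 with h | h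
        · simp [h]
        · field_simp

/-! ### Grouping states into finitely many classes -/

open Classical in
/-- The mass that the weights `w` give to the fibre of `c` over `i`. -/
noncomputable def fibreMass {ι : Type*} (c : K → ι) (w : K → ℝ) (i : ι) : ℝ :=
  ∑' k, if c k = i then w k else 0

section fibreMass

variable {ι : Type*} {c : K → ι} {w : K → ℝ}

open Classical in
theorem summable_ite_fibre (hw : Summable w) (i : ι) :
    Summable fun k => if c k = i then w k else 0 :=
  hw.indicator {k | c k = i}

theorem fibreMass_nonneg (hw0 : ∀ k, 0 ≤ w k) (i : ι) : 0 ≤ fibreMass c w i :=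
  tsum_nonneg fun k => by split_ifs <;> simp [hw0]

theorem sum_fibreMass_mul [Fintype ι] (hw : Summable w) (f : ι → ℝ) :
    ∑ i, fibreMass c w i * f i = ∑' k, w k * f (c k) := by
  classical
  simp only [fibreMass, ← tsum_mul_right]
  rw [← Summable.tsum_finsetSum fun i _ => (summable_ite_fibre hw i).mul_right _]
  refine tsum_congr fun k => ?_
  simp [ite_mul]

theorem sum_fibreMass [Fintype ι] (hw : Summable w) : ∑ i, fibreMass c w i = ∑' k, w k := by
  simpa using sum_fibreMass_mul (c := c) hw fun _ => 1

theorem sum_fibreMass_mul_pmf [Fintype S]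
    (x : K → PMF S) (i : ι) (hx : ∀ s, Summable fun k => w k * (x k s).toReal) :
    ∑ s, fibreMass c (fun k => w k * (x k s).toReal) i = fibreMass c w i := by
  classical
  simp only [fibreMass]
  rw [← Summable.tsum_finsetSum fun s _ => summable_ite_fibre (hx s) i]
  refine tsum_congr fun k => ?_
  split_ifs
  · rw [← Finset.mul_sum, sum_toReal, mul_one]
  · simp

end fibreMass

theorem summable_mul_pmf {w : K → ℝ} (hw0 : ∀ k, 0 ≤ w k) (hw : Summable w) (x : K → PMF S)
    (s : S) : Summable fun k => w k * (x k s).toReal := by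
  refine Summable.of_nonneg_of_le (fun k => mul_nonneg (hw0 k) ENNReal.toReal_nonneg)
    (fun k => ?_) hw
  refine mul_le_of_le_one_right (hw0 k) ?_
  exact ENNReal.toReal_le_of_le_ofReal zero_le_one (by simpa using (x k).coe_le_one s)

theorem summable_mul_bounded {w f : K → ℝ} {B : ℝ} (hw0 : ∀ k, 0 ≤ w k) (hw : Summable w)
    (hf : ∀ k, |f k| ≤ B) : Summable fun k => w k * f k := by
  refine Summable.of_norm_bounded (hw.mul_right B) fun k => ?_
  rw [Real.norm_eq_abs, abs_mul, abs_of_nonneg (hw0 k)]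
  exact mul_le_mul_of_nonneg_left (hf k) (hw0 k)

/-! ### Player 2's reply to a known strategy -/

theorem tsum_mul_pay_succ [Fintype S] [Fintype T] {g : K → S → T → ℝ} {C : ℝ}
    (hg : ∀ k s t, |g k s t| ≤ C) {w : K → ℝ} (hw0 : ∀ k, 0 ≤ w k) (hw : Summable w) (n : ℕ)
    (σ : Strategy1 K S T) (τ : Strategy2 S T) :
    ∑' k, w k * pay (g k) (n + 1) (σ k) τ = ∑ s, ∑ t, (τ [] t).toReal *
      ((∑' k, w k * (σ k [] s).toReal * g k s t) +
        ∑' k, w k * (σ k [] s).toReal *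
          pay (g k) n (fun h => σ k ((s, t) :: h)) (fun h => τ ((s, t) :: h))) := by
  have hws := fun s => summable_mul_pmf hw0 hw (fun k => σ k []) s
  have hws0 : ∀ s k, 0 ≤ w k * (σ k [] s).toReal := fun s k =>
    mul_nonneg (hw0 k) ENNReal.toReal_nonneg
  have h1 := fun s t => summable_mul_bounded (hws0 s) (hws s) (fun k => hg k s t)
  have h2 := fun s t => summable_mul_bounded (hws0 s) (hws s) (fun k => abs_pay_le (hg k) n
    (fun h => σ k ((s, t) :: h)) (fun h => τ ((s, t) :: h)))
  simp_rw [← (h1 _ _).tsum_add (h2 _ _), ← tsum_mul_left]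
  have h3 := fun s t => ((h1 s t).add (h2 s t)).mul_left (τ [] t).toReal
  simp_rw [← Summable.tsum_finsetSum fun t _ => h3 _ t]
  rw [← Summable.tsum_finsetSum fun s _ => summable_sum fun t _ => h3 s t]
  refine tsum_congr fun k => ?_
  simp only [pay, Finset.mul_sum]
  refine Finset.sum_congr rfl fun s _ => Finset.sum_congr rfl fun t _ => ?_
  ring

/-- Entropy serves as a potential: what the first stage gains from revelation is paid by the drop
from the entropy of `w` to the summed entropies after each action. Weights stay unnormalised, so
conditioning on an action `s` is multiplication by its probability and null actions need no separate
case. -/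
theorem exists_tsum_mul_pay_le [Fintype S] [Fintype T] {ι : Type*} [Fintype ι] (c : K → ι)
    {g : ι → S → T → ℝ} {C A η : ℝ} (hC0 : 0 ≤ C) (hg : ∀ i s t, |g i s t| ≤ C) (hA : 0 < A)
    (hη : ∀ P : ι → ℝ, (∀ i, 0 ≤ P i) →
      ∃ y : PMF T, ∀ s, ∑ i, P i * ∑ t, (y t).toReal * g i s t ≤ η * ∑ i, P i)
    (n : ℕ) {w : K → ℝ} (hw0 : ∀ k, 0 ≤ w k) (hw : Summable w) (σ : Strategy1 K S T) :
    ∃ τ : Strategy2 S T, ∑' k, w k * pay (g (c k)) n (σ k) τ ≤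
      n * (2 * C / A + η) * ∑' k, w k + C * A / 2 * massEntropy (fibreMass c w) := by
  induction n generalizing w σ with
  | zero =>
    -- No stage is left; this only supplies some mixed action.
    obtain ⟨y, -⟩ := hη 0 (by simp)
    refine ⟨fun _ => y, ?_⟩
    have := massEntropy_nonneg (fibreMass_nonneg (c := c) hw0)
    simp only [pay, mul_zero, tsum_zero, Nat.cast_zero, zero_mul, zero_add]
    positivity
  | succ n ih =>
    have hws := fun s => summable_mul_pmf hw0 hw (fun k => σ k []) s
    have hws0 : ∀ s k, 0 ≤ w k * (σ k [] s).toReal := fun s k =>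
      mul_nonneg (hw0 k) ENNReal.toReal_nonneg
    obtain ⟨y, hy⟩ := hη (fibreMass c w) (fibreMass_nonneg hw0)
    choose τ' hτ' using fun s t => ih (hws0 s) (hws s) (fun k h => σ k ((s, t) :: h))
    let τ : Strategy2 S T := fun h => match h with
      | [] => y
      | (s, t) :: h => τ' s t h
    refine ⟨τ, ?_⟩
    rw [tsum_mul_pay_succ (fun k => hg (c k)) hw0 hw]
    set a : ι → S → ℝ := fun i s => fibreMass c (fun k => w k * (σ k [] s).toReal) i
    have ha0 : ∀ i s, 0 ≤ a i s := fun i s => fibreMass_nonneg (hws0 s) i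
    have haP : ∀ i, ∑ s, a i s = fibreMass c w i := fun i => sum_fibreMass_mul_pmf _ i hws
    have hstage := stage_le hC0 hg ha0 hA y (η := η) (by simpa only [haP] using hy)
    simp only [haP, sum_fibreMass hw] at hstage
    have hQ : ∑ s, ∑' k, w k * (σ k [] s).toReal = ∑' k, w k := by
      rw [← Summable.tsum_finsetSum fun s _ => hws s]
      simp only [← Finset.mul_sum, sum_toReal, mul_one]
    have e1 : ∑ s, ∑ t, (y t).toReal * ∑' k, w k * (σ k [] s).toReal * g (c k) s t =
        ∑ s, ∑ i, a i s * ∑ t, (y t).toReal * g i s t := by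
      refine Finset.sum_congr rfl fun s _ => ?_
      have e : ∀ t, ∑' k, w k * (σ k [] s).toReal * g (c k) s t = ∑ i, a i s * g i s t :=
        fun t => (sum_fibreMass_mul (hws s) fun i => g i s t).symm
      simp only [e, Finset.mul_sum]
      rw [Finset.sum_comm]
      refine Finset.sum_congr rfl fun i _ => Finset.sum_congr rfl fun t _ => ?_
      ring
    have e2 : ∑ s, ∑ t, (y t).toReal * ∑' k, w k * (σ k [] s).toReal *
          pay (g (c k)) n (fun h => σ k ((s, t) :: h)) (τ' s t) ≤
        ∑ s, ∑ t, (y t).toReal * (n * (2 * C / A + η) * ∑' k, w k * (σ k [] s).toReal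
          + C * A / 2 * massEntropy (fun i => a i s)) := by
      gcongr with s _ t _
      exact hτ' s t
    simp only [← Finset.sum_mul, sum_toReal, one_mul, Finset.sum_add_distrib,
      ← Finset.mul_sum, hQ] at e2
    change ∑ s, ∑ t, (y t).toReal * ((∑' k, w k * (σ k [] s).toReal * g (c k) s t) +
        ∑' k, w k * (σ k [] s).toReal *
          pay (g (c k)) n (fun h => σ k ((s, t) :: h)) (τ' s t)) ≤ _
    simp only [mul_add, Finset.sum_add_distrib] at *
    rw [e1]
    refine (add_le_add hstage e2).trans (le_of_eq ?_)
    push_cast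
    ring

/-! ### Payoff perturbation and the non-revealing game -/

theorem pay_le_add [Fintype S] [Fintype T] {g g' : S → T → ℝ} {ε : ℝ}
    (h : ∀ s t, g s t ≤ g' s t + ε) (n : ℕ) (x : History S T → PMF S) (y : History S T → PMF T) :
    pay g n x y ≤ pay g' n x y + n * ε := by
  induction n generalizing x y with
  | zero => simp [pay]
  | succ n ih =>
    have hc := sum_sum_pmf_le (x []) (y []) (f := fun _ _ => (n + 1) * ε) fun _ _ => le_rfl
    have hm : pay g (n + 1) x y ≤ ∑ s, ∑ t, (x [] s).toReal * (y [] t).toReal *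
        ((g' s t + pay g' n (fun h => x ((s, t) :: h)) (fun h => y ((s, t) :: h)))
          + (n + 1) * ε) := by
      rw [pay]
      refine Finset.sum_le_sum fun s _ => Finset.sum_le_sum fun t _ =>
        mul_le_mul_of_nonneg_left ?_ (by positivity)
      linarith [h s t, ih (fun h => x ((s, t) :: h)) (fun h => y ((s, t) :: h))]
    refine hm.trans ?_
    simp only [mul_add (_ * _) (_ + _) _, Finset.sum_add_distrib]
    rw [pay]
    push_cast
    linarith

theorem gain_one [Fintype S] [Fintype T] {Γ : RGII K S T} {C : ℝ}
    (hC : ∀ k s t, |Γ.payoff k s t| ≤ C) (ρ : PMF K) (σ : History S T → PMF S)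
    (τ : Strategy2 S T) :
    Γ.gain 1 ρ (fun _ => σ) τ =
      ∑ s, (σ [] s).toReal * ∑' k, (ρ k).toReal * ∑ t, (τ [] t).toReal * Γ.payoff k s t := by
  rw [gain_eq_tsum_pay hC]
  simp_rw [← tsum_mul_left]
  rw [← Summable.tsum_finsetSum fun s _ => (summable_mul_bounded (fun _ => ENNReal.toReal_nonneg)
    (summable_toReal ρ) fun k => abs_sum_pmf_mul_le (τ []) (hC k s)).mul_left _]
  refine tsum_congr fun k => ?_
  simp only [pay, Finset.mul_sum]
  refine Finset.sum_congr rfl fun s _ => Finset.sum_congr rfl fun t _ => ?_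
  ring

theorem sum_pmf_pure_mul [Fintype S] (s : S) (f : S → ℝ) :
    ∑ s', ((PMF.pure s : PMF S) s').toReal * f s' = f s := by
  classical
  rw [Finset.sum_eq_single s]
  · simp
  · intro s' _ h
    simp [h]
  · simp

theorem tsum_map_mul {ι : Type*} [Fintype ι] (p : PMF ι) (r : ι → K) (f : K → ℝ) :
    ∑' k, (p.map r k).toReal * f k = ∑ i, (p i).toReal * f (r i) := by
  classical
  have h : ∀ k, (p.map r k).toReal * f k = ∑ i, if k = r i then (p i).toReal * f (r i) else 0 :=
    fun k => by
      rw [PMF.map_apply, tsum_fintype, ENNReal.toReal_sum, Finset.sum_mul]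
      · refine Finset.sum_congr rfl fun i _ => ?_
        split_ifs with h
        · rw [h]
        · simp
      · intro i _
        split_ifs
        · exact p.apply_ne_top i
        · exact ENNReal.zero_ne_top
  simp_rw [h]
  have hs : ∀ i, HasSum (fun k => if k = r i then (p i).toReal * f (r i) else 0)
      ((p i).toReal * f (r i)) := fun i => hasSum_ite_eq (r i) _
  exact (hasSum_sum fun i _ => hs i).tsum_eq

theorem exists_pmf_of_weights {ι : Type*} [Fintype ι] {P : ι → ℝ} (hP : ∀ i, 0 ≤ P i)
    (hW : 0 < ∑ i, P i) : ∃ p : PMF ι, ∀ i, (p i).toReal = P i / ∑ i, P i := by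
  have h0 : ∀ i, 0 ≤ P i / ∑ i, P i := fun i => div_nonneg (hP i) hW.le
  refine ⟨PMF.ofFintype (fun i => ENNReal.ofReal (P i / ∑ i, P i)) ?_, fun i => ?_⟩
  · rw [← ENNReal.ofReal_sum_of_nonneg fun i _ => h0 i, ← Finset.sum_div, div_self hW.ne',
      ENNReal.ofReal_one]
  · rw [PMF.ofFintype_apply, ENNReal.toReal_ofReal (h0 i)]

/-- Normalised class weights, carried to representative states by `r`, form a prior; hence value 0
is needed at every prior. Testing against pure actions of player 1 gives the bound for each `s`. -/
theorem IsNRValue.exists_action [Fintype S] [Fintype T] {Γ : RGII K S T} {C : ℝ}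
    (hC : ∀ k s t, |Γ.payoff k s t| ≤ C) (hnr : ∀ ρ : PMF K, Γ.IsNRValue ρ 0) [Nonempty K]
    {ι : Type*} [Fintype ι] (r : ι → K) {η : ℝ} (hη : 0 < η) {P : ι → ℝ} (hP : ∀ i, 0 ≤ P i) :
    ∃ y : PMF T, ∀ s, ∑ i, P i * ∑ t, (y t).toReal * Γ.payoff (r i) s t ≤ η * ∑ i, P i := by
  have key : ∀ ρ : PMF K, ∃ y : PMF T, ∀ s,
      ∑' k, (ρ k).toReal * ∑ t, (y t).toReal * Γ.payoff k s t ≤ η := fun ρ => by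
    obtain ⟨-, τ, -, h⟩ := hnr ρ η hη
    refine ⟨τ [], fun s => ?_⟩
    have := h fun _ => PMF.pure s
    rwa [gain_one hC, sum_pmf_pure_mul, zero_add] at this
  rcases (Finset.sum_nonneg fun i (_ : i ∈ Finset.univ) => hP i).eq_or_lt with h | h
  · obtain ⟨y, -⟩ := key (PMF.pure (Classical.arbitrary K))
    refine ⟨y, fun s => ?_⟩
    have h' := (Finset.sum_eq_zero_iff_of_nonneg fun i _ => hP i).1 h.symm
    rw [← h]
    simp [fun i => h' i (Finset.mem_univ i)]
  · obtain ⟨p, hp⟩ := exists_pmf_of_weights hP h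
    obtain ⟨y, hy⟩ := key (p.map r)
    refine ⟨y, fun s => ?_⟩
    have := hy s
    rw [tsum_map_mul] at this
    simp only [hp, div_mul_eq_mul_div, ← Finset.sum_div] at this
    rwa [div_le_iff₀ h] at this

/-- Repeating a mixed action that does not depend on the state secures its one-stage
guarantee at every stage. -/
theorem le_tsum_mul_pay_const [Fintype S] [Fintype T] {g : K → S → T → ℝ} {C η : ℝ}
    (hg : ∀ k s t, |g k s t| ≤ C) {w : K → ℝ} (hw0 : ∀ k, 0 ≤ w k) (hw : Summable w) (x : PMF S)
    (hx : ∀ y : PMF T, -η ≤ ∑ s, (x s).toReal * ∑' k, w k * ∑ t, (y t).toReal * g k s t)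
    (n : ℕ) (τ : Strategy2 S T) :
    -(n * η) ≤ ∑' k, w k * pay (g k) n (fun _ => x) τ := by
  induction n generalizing τ with
  | zero => simp [pay]
  | succ n ih =>
    rw [tsum_mul_pay_succ hg hw0 hw (σ := fun _ _ => x)]
    have hcomm : ∀ s (f : K → ℝ), ∑' k, w k * (x s).toReal * f k =
        (x s).toReal * ∑' k, w k * f k := fun s f => by
      rw [← tsum_mul_left]
      exact tsum_congr fun k => by ring
    simp only [hcomm, mul_add, Finset.sum_add_distrib]
    have h1 := hx (τ [])
    have e1 : ∑ s, (x s).toReal * ∑' k, w k * ∑ t, (τ [] t).toReal * g k s t =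
        ∑ s, ∑ t, (τ [] t).toReal * ((x s).toReal * ∑' k, w k * g k s t) := by
      refine Finset.sum_congr rfl fun s _ => ?_
      simp_rw [Finset.mul_sum]
      rw [Summable.tsum_finsetSum fun t _ => ?_, Finset.mul_sum]
      · refine Finset.sum_congr rfl fun t _ => ?_
        simp_rw [← tsum_mul_left]
        exact tsum_congr fun k => by ring
      · refine ((summable_mul_bounded hw0 hw fun k => hg k s t).mul_left (τ [] t).toReal).congr
          fun k => by ring
    -- An upper bound on the negated continuation payoff is the needed lower bound.
    have h2 := sum_sum_pmf_le x (τ []) (f := fun s t =>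
      -∑' k, w k * pay (g k) n (fun _ => x) (fun h => τ ((s, t) :: h))) (B := n * η)
      fun s t => by linarith [ih fun h => τ ((s, t) :: h)]
    have e2 : ∑ s, ∑ t, (x s).toReal * (τ [] t).toReal *
        -(∑' k, w k * pay (g k) n (fun _ => x) (fun h => τ ((s, t) :: h))) =
        -∑ s, ∑ t, (τ [] t).toReal * ((x s).toReal *
          ∑' k, w k * pay (g k) n (fun _ => x) (fun h => τ ((s, t) :: h))) := by
      simp only [← Finset.sum_neg_distrib]
      refine Finset.sum_congr rfl fun s _ => Finset.sum_congr rfl fun t _ => ?_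
      ring
    rw [e2] at h2
    rw [e1] at h1
    push_cast
    linarith

/-! ### Bounds on the value -/

theorem MemClass.value_nonneg [Fintype S] [Fintype T] {Γ : RGII K S T} (hΓ : Γ.MemClass)
    (ρ : PMF K) {N : ℕ} (hN : 1 ≤ N) : 0 ≤ Γ.value N ρ := by
  obtain ⟨C, hC⟩ := hΓ.bounded
  obtain ⟨x, hx⟩ := hΓ.hasValue ρ N hN
  have hN' : (0 : ℝ) < N := by exact_mod_cast hN
  rw [hx.value_eq]
  refine le_of_forall_pos_le_add fun ε hε => ?_
  obtain ⟨σ₀, -, h1, -⟩ := hΓ.nrValue ρ (ε / 2 / N) (by positivity)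
  obtain ⟨-, τ₀, -, h2⟩ := hx (ε / 2) (by positivity)
  have h3 := le_tsum_mul_pay_const (η := ε / 2 / N) hC (fun k => ENNReal.toReal_nonneg)
    (summable_toReal ρ) (σ₀ []) (fun y => by
      have := h1 fun _ => y
      rwa [gain_one hC, zero_sub] at this) N τ₀
  have h4 := h2 fun _ _ => σ₀ []
  rw [gain_eq_tsum_pay hC] at h4
  rw [mul_div_cancel₀ _ hN'.ne'] at h3
  linarith

/-- The constant 3 collects one unit each from the 1-optimality of `σ`, the `N` errors `η = 1 / N`,
and rounding. -/
theorem MemClass.value_le [Fintype S] [Fintype T] {Γ : RGII K S T} (hΓ : Γ.MemClass) {C : ℝ}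
    (hC0 : 0 ≤ C) (hC : ∀ k s t, |Γ.payoff k s t| ≤ C) (ρ : PMF K) {N : ℕ} (hN : 1 ≤ N) :
    Γ.value N ρ ≤ 3 + 2 * C * √N +
      C * √N / 2 * (Fintype.card S * (Fintype.card T * Real.log ((2 * C + 1) * N))) := by
  classical
  have hN' : (1 : ℝ) ≤ N := by exact_mod_cast hN
  have hN0 : (0 : ℝ) < N := by linarith
  obtain ⟨x, hx⟩ := hΓ.hasValue ρ N hN
  rw [hx.value_eq]
  obtain ⟨σ, -, h1, -⟩ := hx 1 one_pos
  have : Nonempty K := ⟨ρ.support_nonempty.some⟩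
  -- Shifted payoffs times `N` lie in `[0, 2 * C * N]`, so their integer parts take at most `L`
  -- values.
  set L : ℕ := ⌊2 * C * N⌋₊ + 1
  have hpos : ∀ k s t, 0 ≤ (Γ.payoff k s t + C) * N := fun k s t =>
    mul_nonneg (by linarith [(abs_le.1 (hC k s t)).1]) hN0.le
  let c : K → S → T → Fin L := fun k s t => ⟨⌊(Γ.payoff k s t + C) * N⌋₊,
    Nat.lt_succ_of_le (Nat.floor_le_floor (mul_le_mul_of_nonneg_right
      (by linarith [(abs_le.1 (hC k s t)).2]) hN0.le))⟩
  -- A representative state for each rounded matrix; matrices that do not occur get an arbitrary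
  -- state.
  let r : (S → T → Fin L) → K := Function.invFun c
  have hr : ∀ k, c (r (c k)) = c k := fun k => Function.invFun_eq ⟨k, rfl⟩
  have hclose : ∀ k s t, Γ.payoff k s t ≤ Γ.payoff (r (c k)) s t + 1 / N := fun k s t => by
    have hfl : ⌊(Γ.payoff (r (c k)) s t + C) * N⌋₊ = ⌊(Γ.payoff k s t + C) * N⌋₊ :=
      congrArg Fin.val (congrFun (congrFun (hr k) s) t)
    have h2 := Nat.lt_floor_add_one ((Γ.payoff k s t + C) * N)
    have h3 := Nat.floor_le (hpos (r (c k)) s t)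
    rw [hfl] at h3
    have h4 : (Γ.payoff k s t - Γ.payoff (r (c k)) s t) * N ≤ 1 := by linarith
    have := (le_div_iff₀ hN0).2 h4
    linarith
  -- `A = √N` balances `N * (2 * C / A)` against `C * A / 2` times the entropy, up to the logarithm.
  obtain ⟨τ, hτ⟩ := exists_tsum_mul_pay_le c (g := fun i => Γ.payoff (r i)) (A := √N)
    (η := 1 / N) hC0 (fun i => hC (r i)) (by positivity)
    (fun P hP => IsNRValue.exists_action hC hΓ.nrValue r (by positivity) hP) N
    (fun k => ENNReal.toReal_nonneg) (summable_toReal ρ) σ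
  have h2 := h1 τ
  rw [gain_eq_tsum_pay hC] at h2
  have h3 : ∑' k, (ρ k).toReal * pay (Γ.payoff k) N (σ k) τ ≤
      ∑' k, (ρ k).toReal * pay (Γ.payoff (r (c k))) N (σ k) τ + 1 := by
    have s1 := summable_mul_bounded (fun k => ENNReal.toReal_nonneg) (summable_toReal ρ)
      fun k => abs_pay_le (hC k) N (σ k) τ
    have s2 := summable_mul_bounded (fun k => ENNReal.toReal_nonneg) (summable_toReal ρ)
      fun k => abs_pay_le (hC (r (c k))) N (σ k) τ
    rw [← tsum_toReal ρ]
    rw [← s2.tsum_add (summable_toReal ρ)]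
    refine s1.tsum_le_tsum (fun k => ?_) (s2.add (summable_toReal ρ))
    have := mul_le_mul_of_nonneg_left (pay_le_add (hclose k) N (σ k) τ)
      (ENNReal.toReal_nonneg (a := ρ k))
    rw [mul_one_div_cancel hN0.ne'] at this
    linarith
  have h4 := massEntropy_le_log_card
    (fibreMass_nonneg (c := c) fun k => ENNReal.toReal_nonneg (a := ρ k))
    (by rw [sum_fibreMass (summable_toReal ρ), tsum_toReal])
  have hL : Real.log L ≤ Real.log ((2 * C + 1) * N) := by
    refine Real.log_le_log (by positivity) ?_
    have := Nat.floor_le (show 0 ≤ 2 * C * N by positivity)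
    push_cast [L]
    linarith
  have h5 : Real.log (Fintype.card (S → T → Fin L)) ≤
      Fintype.card S * (Fintype.card T * Real.log ((2 * C + 1) * N)) := by
    simp only [Fintype.card_fun, Fintype.card_fin, Nat.cast_pow, Real.log_pow]
    gcongr
  have h6 := mul_le_mul_of_nonneg_left (h4.trans h5) (show 0 ≤ C * √N / 2 by positivity)
  have h7 : (N : ℝ) * (2 * C / √N + 1 / N) = 2 * C * √N + 1 := by
    have : (N : ℝ) = √N * √N := (Real.mul_self_sqrt hN0.le).symm
    rw [mul_add, mul_one_div_cancel hN0.ne']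
    congr 1
    nth_rw 1 [this]
    field_simp
  rw [tsum_toReal, h7] at hτ
  linarith

/-! ### Asymptotics and growth exponent -/

theorem isLittleO_sqrt_mul_log {δ : ℝ} (hδ : 0 < δ) (B₁ B₂ B₃ B₄ : ℝ) {a : ℝ} (ha : 0 < a) :
    (fun N : ℕ => B₁ + B₂ * √N + B₃ * √N / 2 * (B₄ * Real.log (a * N))) =o[atTop]
      (fun N : ℕ => (N : ℝ) ^ ((1 : ℝ) / 2 + δ)) := by
  have key : (fun x : ℝ => B₁ + B₂ * √x + B₃ * √x / 2 * (B₄ * Real.log (a * x))) =o[atTop]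
      (fun x : ℝ => x ^ ((1 : ℝ) / 2 + δ)) := by
    have hmul : (fun x : ℝ => x ^ ((1 : ℝ) / 2 + δ)) =ᶠ[atTop] fun x : ℝ => √x * x ^ δ := by
      filter_upwards [eventually_gt_atTop 0] with x hx
      rw [Real.rpow_add hx, Real.sqrt_eq_rpow]
    have hone : (fun _ : ℝ => (1 : ℝ)) =o[atTop] fun x : ℝ => x ^ δ :=
      (isLittleO_one_left_iff ℝ).2 (tendsto_norm_atTop_atTop.comp (tendsto_rpow_atTop hδ))
    have hlog : (fun x : ℝ => Real.log (a * x)) =o[atTop] fun x : ℝ => x ^ δ := by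
      have h := (hone.const_mul_left (Real.log a)).add (isLittleO_log_rpow_atTop hδ)
      refine h.congr' ?_ EventuallyEq.rfl
      filter_upwards [eventually_gt_atTop 0] with x hx
      rw [Real.log_mul ha.ne' hx.ne', mul_one]
    refine IsLittleO.add (IsLittleO.add ?_ ?_) ?_
    · have : (fun _ : ℝ => (1 : ℝ)) =o[atTop] fun x : ℝ => x ^ ((1 : ℝ) / 2 + δ) :=
        (isLittleO_one_left_iff ℝ).2
          (tendsto_norm_atTop_atTop.comp (tendsto_rpow_atTop (by positivity)))
      simpa using this.const_mul_left B₁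
    · refine IsLittleO.const_mul_left ?_ _
      refine IsLittleO.congr' ((isBigO_refl Real.sqrt atTop).mul_isLittleO hone) ?_ hmul.symm
      exact .of_forall fun x => mul_one _
    · refine IsLittleO.congr' (((isBigO_refl Real.sqrt atTop).mul_isLittleO hlog).const_mul_left
        (B₃ / 2 * B₄)) ?_ hmul.symm
      exact .of_forall fun x => by ring
  exact key.comp_tendsto tendsto_natCast_atTop_atTop

theorem MemClass.value_isLittleO [Finite S] [Finite T] {Γ : RGII K S T} (hΓ : Γ.MemClass)
    (ρ : PMF K) {δ : ℝ} (hδ : 0 < δ) :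
    (fun N : ℕ => Γ.value N ρ) =o[atTop] (fun N : ℕ => (N : ℝ) ^ ((1 : ℝ) / 2 + δ)) := by
  have := Fintype.ofFinite S
  have := Fintype.ofFinite T
  obtain ⟨C, hC⟩ := hΓ.bounded
  have hC' : ∀ k s t, |Γ.payoff k s t| ≤ |C| := fun k s t => (hC k s t).trans (le_abs_self C)
  refine IsBigO.trans_isLittleO (IsBigO.of_bound 1 ?_) (isLittleO_sqrt_mul_log hδ 3 (2 * |C|) |C|
    (Fintype.card S * Fintype.card T) (a := 2 * |C| + 1) (by positivity))
  filter_upwards [eventually_ge_atTop 1] with N hN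
  rw [one_mul, Real.norm_of_nonneg (hΓ.value_nonneg ρ hN), mul_assoc (Fintype.card S : ℝ)]
  exact (hΓ.value_le (abs_nonneg C) hC' ρ hN).trans (Real.le_norm_self _)

theorem growthExponent_le_zero {Γ : RGII K S T} {ρ : PMF K}
    (h : ∀ δ : ℝ, 0 < δ →
      (fun N : ℕ => Γ.value N ρ) =o[atTop] (fun N : ℕ => (N : ℝ) ^ ((1 : ℝ) / 2 + δ))) :
    Γ.growthExponent ρ ≤ 0 := by
  have key : ∀ δ : ℝ, 0 < δ → limsup (fun N : ℕ =>
      ENNReal.log (ENNReal.ofReal (Γ.value N ρ)) / ((Real.log (N : ℝ) : ℝ) : EReal)) atTop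
        ≤ (((1 : ℝ) / 2 + δ : ℝ) : EReal) := fun δ hδ => by
    refine limsup_le_of_le (by isBoundedDefault) ?_
    -- `N ≥ 2` makes `log N` positive, so the division can be cleared.
    filter_upwards [(h δ hδ).bound one_pos, eventually_ge_atTop 2] with N hN hN2
    have hN2' : (1 : ℝ) < N := by exact_mod_cast hN2
    have hpos : 0 < (N : ℝ) ^ ((1 : ℝ) / 2 + δ) := by positivity
    rw [one_mul, Real.norm_of_nonneg hpos.le] at hN
    have hlog : 0 < Real.log N := Real.log_pos hN2'
    rw [EReal.div_le_iff_le_mul (by exact_mod_cast hlog) (EReal.coe_ne_top _)]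
    refine (ENNReal.log_monotone (ENNReal.ofReal_le_ofReal
      ((Real.le_norm_self _).trans hN))).trans (le_of_eq ?_)
    rw [ENNReal.log_ofReal_of_pos hpos, Real.log_rpow (by positivity), mul_comm, EReal.coe_mul]
  rw [growthExponent, EReal.sub_nonpos]
  -- Every real `z > 1 / 2` bounds the limsup, by taking `δ = z - 1 / 2`.
  refine EReal.le_of_forall_lt_iff_le.1 fun z hz => ?_
  have hz' : (1 : ℝ) / 2 < z := by exact_mod_cast hz
  simpa using key (z - 1 / 2) (by linarith)

theorem MemClass.infinite_actions {Γ : RGII K S T} (hΓ : Γ.MemClass) {ρ : PMF K}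
    (h : 0 < Γ.growthExponent ρ) : Infinite S ∨ Infinite T := by
  by_contra! hfin
  obtain ⟨hS, hT⟩ := hfin
  exact h.not_ge (growthExponent_le_zero fun δ hδ => hΓ.value_isLittleO ρ hδ)

end RGII

theorem mainTheorem4 {K : Type*} [Countable K] (ρ : PMF K) :
    (∀ (S : Type*) (T : Type*) [Finite S] [Finite T] (Γ : RGII K S T), Γ.MemClass →
      ∀ δ : ℝ, 0 < δ →
        (fun N : ℕ => Γ.value N ρ) =o[atTop] (fun N : ℕ => (N : ℝ) ^ ((1 : ℝ) / 2 + δ))) ∧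
    (∀ (S : Type*) (T : Type*) (Γ : RGII K S T), Γ.MemClass → 0 < Γ.growthExponent ρ →
      Infinite S ∨ Infinite T) ∧
    (0 < RGII.alpha ρ → ∃ (S : Type) (T : Type) (Γ : RGII K S T),
      Γ.MemClass ∧ 0 < Γ.growthExponent ρ ∧ (Infinite S ∨ Infinite T)) := by
  refine ⟨fun S T _ _ Γ hΓ δ hδ => hΓ.value_isLittleO ρ hδ,
    fun S T Γ hΓ h => hΓ.infinite_actions h, fun h => ?_⟩
  simp only [RGII.alpha, lt_iSup_iff] at h
  obtain ⟨S, T, Γ, hΓ, h⟩ := h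
  exact ⟨S, T, Γ, hΓ, h, hΓ.infinite_actions h⟩
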